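/- Let $G=(A,B,E)$ be a finite bipartite graph in which every edge $e$ is realized independently with a known probability $p_e\in[0,1]$. Let $E_w$ be the set of edges incident to a vertex $w$. Let $\mathbf x=(x_e)_{e\in E}$ be any feasible solution of the matching LP, that is, $x_e\ge 0$ for all $e\in E$, and $\sum_{f\in F}x_f\le 1-\prod_{f\in F}(1-p_f)$ for every vertex $w\in A\cup B$ and every $F\subseteq E_w$. Put $$g(x)=\frac{(e-1)(1-x)x}{e-e^{x}}\ \ (0\le x<1),\qquad g(1)=1-\frac1e .$$ The algorithm $\mathrm{Alg1}(G,\mathbf x,1)$ is as follows. 1. For each $u\in B$ add to $A$ a new vertex joined only to $u$, by a dummy edge $f$ with $p_f=1$ and $x_f=1-\sum_{f'\in E_u}x_{f'}$ (sum over the original edges). Put $\tilde x_f=g(x_f)$ for every edge $f$. Start with the empty matching $\mathcal M_1$. 2. For each vertex $v$ of the enlarged set $A$ fix a distribution $\mathcal D_v$ over permutations of subsets of $E_v$ that is proportional to $\mathbf x$: for each $f\in E_v$, the probability that $f$ is the first realized edge in a permutation drawn from $\mathcal D_v$ is exactly $x_f$. 3. Process the vertices $v$ of the enlarged set $A$ in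 a uniformly random order. At $v$: - Draw $\pi_v\sim\mathcal D_v$ and form $\pi'_v$ by scanning $\pi_v$. At each edge $f$ draw a fresh uniform $c\in[0,1]$. If $c\le p_f(1-\tilde x_f/x_f)$, end the scan. If $p_f(1-\tilde x_f/x_f)<c\le p_f(1-\tilde x_f/x_f)+\tilde x_f/x_f$, append $f$ to $\pi'_v$. (If $x_f=0$, the ratio $\tilde x_f/x_f$ is read as its limit $1$.) - Examine the edges of $\pi'_v$ in order until one is found realized. Each examined edge $f$ is found realized with probability $p_f$, independently of everything else. - If a realized edge $f=(v,u)$ is found and $u$ is unmatched, $f$ joins $\mathcal M_1$. If $u$ is already matched, the proposal is rejected. In both cases the turn of $v$ ends. All random choices are independent. Let $E_2$ be the set of available edges after one run: the edges of $E$ that were not examined and share no end-point with an edge of $\mathcal M_1$ (dummy edges in $\mathcal M_1$ count). Then, for any choice of the proportional distributions $\mathcal D_v$ and for every $e\in E$ with $p_e>0$, $$\Pr[e\in E_2]\ \ge\ \Bigl(1-\frac{\tilde x_e}{p_e}\Bigr)\Bigl(\frac{1-1/e}{2}\Bigr)^2,$$ where in $1/e$ and in the definition of $g$ the letter $e$ denotes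 Euler's number. -/

import Mathlib

open MeasureTheory

namespace StochasticMatching

/-- A stochastic bipartite graph with parts `V` and `U`: the finite edge set `E`, and for every edge
the probability `p e ∈ [0, 1]` with which it is realized, independently of all other edges.
(Edge weights play no role for feasibility and rounding, so they are not recorded.) -/
structure BipartiteGraph (V U : Type*) where
  /-- the edges -/
  E : Finset (V × U)
  /-- the realization probabilities -/
  p : V × U → unitInterval

section Linear

variable {V U : Type*}

/-- `x` is a (feasible, not necessarily optimal) solution of the matching linear program: `x ≥ 0`, and
for every vertex (of either part) and every set `F` of edges incident to it,
`∑_{e ∈ F} x_e ≤ Pr[an edge of F exists] = 1 - ∏_{e ∈ F} (1 - p_e)`. -/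
structure IsLPSolution (G : BipartiteGraph V U) (x : V × U → ℝ) : Prop where
  nonneg : ∀ e ∈ G.E, 0 ≤ x e
  left : ∀ v : V, ∀ F ⊆ G.E, (∀ e ∈ F, e.1 = v) → ∑ e ∈ F, x e ≤ 1 - ∏ e ∈ F, (1 - (G.p e : ℝ))
  right : ∀ u : U, ∀ F ⊆ G.E, (∀ e ∈ F, e.2 = u) → ∑ e ∈ F, x e ≤ 1 - ∏ e ∈ F, (1 - (G.p e : ℝ))

end Linear

/-- The transformation `g(x, σ) = (e^σ - 1)(σ - x) x / (σ (e^σ - e^x))` for `x ∈ [0, σ)`, extended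
continuously by `g(σ, σ) = 1 - e^{-σ}`. -/
noncomputable def g (x σ : ℝ) : ℝ :=
  if x = σ then 1 - Real.exp (-σ)
  else (Real.exp σ - 1) * (σ - x) * x / (σ * (Real.exp σ - Real.exp x))

/-- The biased coin: `true` with probability `p`. -/
noncomputable def coin (p : unitInterval) : PMF Bool :=
  (ProbabilityTheory.bernoulliMeasure true false p).toPMF

section Scan

variable {V U : Type*}

/-- Examine the edges of a list in order and halt at the first one that is realized. The result is the
list of the edges that were examined, and the realized edge (if any). Examining `e` means querying it or
tossing a coin of the same bias `p e`; either way it is found realized with probability `p e`,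
independently of everything else (no edge is examined twice). -/
noncomputable def scan (p : V × U → unitInterval) :
    List (V × U) → PMF (List (V × U) × Option (V × U))
  | [] => PMF.pure ([], none)
  | e :: l => (coin (p e)).bind fun realized =>
      if realized then PMF.pure ([e], some e)
      else (scan p l).map fun r => (e :: r.1, r.2)

/-- The distribution `D` over lists is a distribution over permutations of subsets of `E_v` that is
proportional to `x`: every edge `e ∈ E_v` is the first realized edge of the random permutation with
probability exactly `x e`. -/
structure IsProportional (G : BipartiteGraph V U) (x : V × U → ℝ) (v : V)
    (D : PMF (List (V × U))) : Prop where
  perm : ∀ l ∈ D.support, l.Nodup ∧ ∀ e ∈ l, e ∈ G.E ∧ e.1 = v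
  prob_eq : ∀ e ∈ G.E, e.1 = v →
    ((D.bind (scan G.p)).map Prod.snd) (some e) = ENNReal.ofReal (x e)

end Scan

/-- What happens to one edge of the list in the thinning procedure `thin`. -/
inductive Decision
  /-- the loop ends -/
  | halt
  /-- the edge is added to the new permutation -/
  | add
  /-- the edge is not added, and the loop goes on -/
  | skip

instance : MeasurableSpace Decision := ⊤

instance : Countable Decision :=
  Function.Injective.countable
    (f := fun d : Decision => match d with | .halt => (0 : ℕ) | .add => 1 | .skip => 2)
    (by intro a b h; cases a <;> cases b <;> simp_all)

/-- The decision made from the number `c ∈ [0, 1]` for an edge with realization probability `p` and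
ratio `r = x̃_e / x_e`. -/
noncomputable def decision (p r : ℝ) (c : unitInterval) : Decision :=
  if (c : ℝ) ≤ p * (1 - r) then .halt
  else if (c : ℝ) ≤ p * (1 - r) + r then .add
  else .skip

theorem measurable_decision (p r : ℝ) : Measurable (decision p r) := by
  unfold decision
  refine Measurable.ite (measurableSet_le measurable_subtype_coe measurable_const)
    measurable_const ?_
  exact Measurable.ite (measurableSet_le measurable_subtype_coe measurable_const)
    measurable_const measurable_const

/-- The law of the decision when `c` is drawn uniformly from `[0, 1]`. -/
noncomputable def drawDecision (p r : ℝ) : PMF Decision :=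
  haveI : IsProbabilityMeasure ((volume : Measure unitInterval).map (decision p r)) :=
    Measure.isProbabilityMeasure_map (measurable_decision p r).aemeasurable
  ((volume : Measure unitInterval).map (decision p r)).toPMF

/-- The ratio `y / x` of the transformed to the original value, with the limit value `1` of `g(x, σ) / x`
when `x = 0`. -/
noncomputable def ratio (x y : ℝ) : ℝ := if x = 0 then 1 else y / x

section Alg

variable {V U : Type*}

/-- The thinning of a permutation `π_v`: go through its edges in order, each time drawing `c` uniformly
from `[0, 1]`; end the loop if `c ≤ p_e (1 - x̃_e/x_e)`, and add `e` to the end of the new permutation if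
`p_e (1 - x̃_e/x_e) < c ≤ p_e (1 - x̃_e/x_e) + x̃_e/x_e`. -/
noncomputable def thin (p : V × U → unitInterval) (x y : V × U → ℝ) :
    List (V × U) → PMF (List (V × U))
  | [] => PMF.pure []
  | e :: l => (drawDecision (p e) (ratio (x e) (y e))).bind fun
      | .halt => PMF.pure []
      | .add => (thin p x y l).map (e :: ·)
      | .skip => thin p x y l

/-- The state of the algorithm: the edges examined so far and the current matching. -/
structure State (V U : Type*) where
  /-- the edges that have been examined -/
  examined : Finset (V × U)
  /-- the edges that have joined the matching -/
  matching : Finset (V × U)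

variable [DecidableEq V] [DecidableEq U]

/-- The effect of a proposal along the edge `e = (v, u)`: it is accepted iff `u` is unmatched. -/
def propose (M : Finset (V × U)) : Option (V × U) → Finset (V × U)
  | none => M
  | some e => if ∀ m ∈ M, m.2 ≠ e.2 then insert e M else M

/-- The turn of one vertex: draw a permutation from `D`, thin it, examine the edges of the result until
one is realized, and propose along that edge. -/
noncomputable def turn (p : V × U → unitInterval) (x y : V × U → ℝ) (D : PMF (List (V × U)))
    (s : State V U) : PMF (State V U) :=
  ((D.bind (thin p x y)).bind (scan p)).map fun r =>
    ⟨s.examined ∪ r.1.toFinset, propose s.matching r.2⟩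

/-- The turns of all vertices of a list, in order. -/
noncomputable def turns (p : V × U → unitInterval) (x y : V × U → ℝ) (D : V → PMF (List (V × U))) :
    List V → State V U → PMF (State V U)
  | [], s => PMF.pure s
  | v :: l, s => (turn p x y (D v) s).bind (turns p x y D l)

end Alg

/-- A uniformly random ordering of the elements of a finite type. -/
noncomputable def randomOrder (V : Type*) [Fintype V] [DecidableEq V] : PMF (List V) :=
  haveI : Nonempty (Fin (Fintype.card V) ≃ V) := ⟨(Fintype.equivFin V).symm⟩
  (PMF.uniformOfFintype (Fin (Fintype.card V) ≃ V)).map fun π => List.ofFn (π : Fin (Fintype.card V) → V)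

section Dummy

variable {A B : Type*} [DecidableEq A] [DecidableEq B]

/-- The edge of the enlarged graph that corresponds to an original edge. -/
def lift (e : A × B) : (A ⊕ B) × B := (Sum.inl e.1, e.2)

/-- The graph with dummy edges: for every `u ∈ B` there is a new vertex `inr u` on the left side, and the
dummy edge `(inr u, u)` with realization probability `1`. -/
def withDummies [Fintype B] (G : BipartiteGraph A B) : BipartiteGraph (A ⊕ B) B where
  E := G.E.image lift ∪ Finset.univ.image fun u => (Sum.inr u, u)
  p e := match e with
    | (Sum.inl v, u) => G.p (v, u)
    | (Sum.inr _, _) => 1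

/-- The values on the graph with dummy edges: the dummy edge at `u` gets the value
`σ - ∑_{e ∋ u} x_e`. -/
def withDummyValues (G : BipartiteGraph A B) (x : A × B → ℝ) (σ : ℝ) : (A ⊕ B) × B → ℝ
  | (Sum.inl v, u) => x (v, u)
  | (Sum.inr _, u) => σ - ∑ e ∈ G.E with e.2 = u, x e

/-- The law of the final state of one run of the rounding algorithm `Alg1(G, x, σ)`. The dummy edges are
added, `x̃ = g(x, σ)` is computed, and the vertices of the left side take their turns in a uniformly random
order. `D v` is the distribution (proportional to `x`) from which vertex `v` draws its permutation before
thinning. -/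
noncomputable def alg1 [Fintype A] [Fintype B] (G : BipartiteGraph A B) (x : A × B → ℝ) (σ : ℝ)
    (D : A ⊕ B → PMF (List ((A ⊕ B) × B))) : PMF (State (A ⊕ B) B) :=
  (randomOrder (A ⊕ B)).bind fun order =>
    turns (withDummies G).p (withDummyValues G x σ) (fun e => g (withDummyValues G x σ e) σ) D
      order ⟨∅, ∅⟩

/-- The set `E₂` of available edges in a final state: the edges of `G` that are not examined and share no
end-point with an edge of the matching. -/
def available (G : BipartiteGraph A B) (s : State (A ⊕ B) B) : Finset (A × B) :=
  {e ∈ G.E | lift e ∉ s.examined ∧ ∀ m ∈ s.matching, m.1 ≠ (lift e).1 ∧ m.2 ≠ (lift e).2}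

end Dummy

/-- The probability of the event `S` under the law `P`. -/
noncomputable def prob {α : Type*} (P : PMF α) (S : Set α) : ℝ := (P.toOuterMeasure S).toReal

end StochasticMatching

open scoped ENNReal

namespace StochasticMatching

/-! Fix the edge e = (v, u), let r_f = g(x_f)/x_f and c = (1 - 1/`exp 1`)/2. The edge e is available
as soon as (i) no vertex other than v proposes to u, (ii) v does not examine e, and (iii) v makes no
proposal, or its proposal is rejected because the other end-point of the proposed edge was matched
earlier.

Thinning keeps each edge with probability r_f, and when it drops the edge it still ends the scan
with probability p_f. Hence the chance of getting past an edge stays 1 - p_f, and every edge f is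
proposed with probability r_f x_f = g(x_f). It follows that e is examined with probability at most
g(x_e)/p_e (`one_le_expect_unexamined_add`).

For (i), let P be the product of 1 - g over the other edges at u. It does not depend on the order,
and P ≥ c because the x-values at u sum to at most 1 (`le_prod_one_sub_g`).

For (iii), let v propose along f = (v, u'), and let R be the product of 1 - g over the other edges
at u'. A vertex never proposes to both u and u', so given that u gets no proposal, proposals to u'
only become likelier. Averaging an order with its reverse shows that, given (i), u' is matched
before v's turn with probability at least (1 - R)/2 (`HasProposalLaw.expect_meanValue_le`). The
dummy edges bring the sum of the x-values at u' to exactly 1, so 1 - g(t) ≤ exp(-t) yields R ≤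
exp(-(1 - x_f)).

When the scan of v stops at f, there is no proposal with probability 1 - r_f and a proposal with
probability r_f, so (iii) has conditional probability at least 1 - r_f + r_f (1 - exp(-(1 -
x_f)))/2. The function g is designed so that the last term equals c (1 - x_f), and r_f ≤ 1 - c x_f
makes the whole at least c. The two factors c, from P and from (iii), give the square. -/

/-- The expectation of a nonnegative function under a `PMF`. -/
noncomputable def expect {α : Type*} (P : PMF α) (F : α → ℝ≥0∞) : ℝ≥0∞ := ∑' a, P a * F a

/-! ### Calculus of expectations with values in `ℝ≥0∞`, free of summability conditions. -/

section Expect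

variable {α β : Type*}

theorem expect_pure (a : α) (F : α → ℝ≥0∞) : expect (PMF.pure a) F = F a := by
  unfold expect
  rw [tsum_eq_single a]
  · simp
  · intro b hb
    simp [PMF.pure_apply, hb]

theorem expect_bind (P : PMF α) (k : α → PMF β) (F : β → ℝ≥0∞) :
    expect (P.bind k) F = expect P fun a => expect (k a) F := by
  unfold expect
  simp_rw [PMF.bind_apply, ← ENNReal.tsum_mul_right, ← ENNReal.tsum_mul_left]
  rw [ENNReal.tsum_comm]
  simp_rw [mul_assoc]

theorem expect_map (P : PMF α) (k : α → β) (F : β → ℝ≥0∞) :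
    expect (P.map k) F = expect P fun a => F (k a) := by
  rw [← PMF.bind_pure_comp, expect_bind]
  simp [expect_pure]

theorem expect_mono {P : PMF α} {F F' : α → ℝ≥0∞} (h : ∀ a ∈ P.support, F a ≤ F' a) :
    expect P F ≤ expect P F' := by
  refine ENNReal.tsum_le_tsum fun a => ?_
  by_cases ha : a ∈ P.support
  · gcongr
    exact h a ha
  · rw [PMF.mem_support_iff, not_not] at ha
    simp [ha]

theorem expect_congr {P : PMF α} {F F' : α → ℝ≥0∞} (h : ∀ a ∈ P.support, F a = F' a) :
    expect P F = expect P F' :=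
  le_antisymm (expect_mono fun a ha => (h a ha).le) (expect_mono fun a ha => (h a ha).ge)

theorem expect_add (P : PMF α) (F F' : α → ℝ≥0∞) :
    (expect P fun a => F a + F' a) = expect P F + expect P F' := by
  simp [expect, mul_add, ENNReal.tsum_add]

theorem expect_const_mul (P : PMF α) (c : ℝ≥0∞) (F : α → ℝ≥0∞) :
    (expect P fun a => c * F a) = c * expect P F := by
  simp [expect, mul_left_comm _ c, ENNReal.tsum_mul_left]

theorem expect_mul_const (P : PMF α) (c : ℝ≥0∞) (F : α → ℝ≥0∞) :
    (expect P fun a => F a * c) = expect P F * c := by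
  simp_rw [mul_comm _ c, expect_const_mul]

theorem expect_const (P : PMF α) (c : ℝ≥0∞) : (expect P fun _ => c) = c := by
  simp [expect, ENNReal.tsum_mul_right, P.tsum_coe]

theorem expect_comm (P : PMF α) (Q : PMF β) (F : α → β → ℝ≥0∞) :
    (expect P fun a => expect Q fun b => F a b) = expect Q fun b => expect P fun a => F a b := by
  unfold expect
  simp_rw [← ENNReal.tsum_mul_left]
  rw [ENNReal.tsum_comm]
  simp_rw [mul_left_comm]

theorem expect_indicator (P : PMF α) (S : Set α) :
    expect P (S.indicator 1) = P.toOuterMeasure S := by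
  rw [PMF.toOuterMeasure_apply]
  refine tsum_congr fun a => ?_
  by_cases h : a ∈ S <;> simp [h]

theorem expect_single (P : PMF α) (a : α) : expect P (({a} : Set α).indicator 1) = P a := by
  rw [expect_indicator, PMF.toOuterMeasure_apply_singleton]

end Expect

/-! ### Laws of the coin and of the thinning decision. -/

theorem expect_coin (p : unitInterval) (F : Bool → ℝ≥0∞) :
    expect (coin p) F = ENNReal.ofReal p * F true + ENNReal.ofReal (1 - p) * F false := by
  unfold expect coin
  rw [tsum_bool, add_comm]
  congr 2
  · rw [Measure.toPMF_apply, ProbabilityTheory.bernoulliMeasure_apply_of_mem_of_notMem _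
      (MeasurableSet.singleton _) (by simp) (by simp), ENNReal.ofReal, Real.toNNReal_of_nonneg p.2.1]
    rfl
  · rw [Measure.toPMF_apply, ProbabilityTheory.bernoulliMeasure_apply_of_notMem_of_mem _
      (MeasurableSet.singleton _) (by simp) (by simp), ENNReal.ofReal,
      Real.toNNReal_of_nonneg (sub_nonneg.2 p.2.2)]
    rfl

theorem volume_unitInterval_le {a : ℝ} (h0 : 0 ≤ a) (h1 : a ≤ 1) :
    (volume : Measure unitInterval) {c | (c : ℝ) ≤ a} = ENNReal.ofReal a := by
  have : {c : unitInterval | (c : ℝ) ≤ a} = Set.Iic ⟨a, h0, h1⟩ := by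
    ext c
    simp [← Subtype.coe_le_coe]
  rw [this, unitInterval.volume_Iic]

theorem tsum_decision (F : Decision → ℝ≥0∞) :
    ∑' d, F d = F .halt + F .add + F .skip := by
  classical
  rw [tsum_eq_sum (s := {.halt, .add, .skip})]
  · rw [Finset.sum_insert, Finset.sum_insert, Finset.sum_singleton, add_assoc] <;> simp
  · intro d hd
    cases d <;> simp at hd

/-- The three weights are those of two independent coins: one of bias r keeps the edge, and if it is
dropped, one of bias p decides whether the scan ends anyway. -/
theorem expect_drawDecision {p r : ℝ} (hp0 : 0 ≤ p) (hp1 : p ≤ 1) (hr0 : 0 ≤ r) (hr1 : r ≤ 1)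
    (F : Decision → ℝ≥0∞) :
    expect (drawDecision p r) F = ENNReal.ofReal (p * (1 - r)) * F .halt +
      ENNReal.ofReal r * F .add + ENNReal.ofReal ((1 - p) * (1 - r)) * F .skip := by
  have h1 : 0 ≤ p * (1 - r) := mul_nonneg hp0 (by linarith)
  have h2 : p * (1 - r) + r ≤ 1 := by nlinarith
  have happ (d : Decision) : drawDecision p r d =
      (volume : Measure unitInterval) (decision p r ⁻¹' {d}) := by
    unfold drawDecision
    rw [Measure.toPMF_apply, Measure.map_apply (measurable_decision p r) trivial]
  have hh : drawDecision p r .halt = ENNReal.ofReal (p * (1 - r)) := by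
    rw [happ, ← volume_unitInterval_le h1 (by linarith)]
    congr 1
    ext c
    simp only [Set.mem_preimage, Set.mem_singleton_iff, decision, Set.mem_ofPred_eq]
    split_ifs <;> simp_all
  have hha : drawDecision p r .halt + drawDecision p r .add =
      ENNReal.ofReal (p * (1 - r) + r) := by
    rw [happ, happ, ← volume_unitInterval_le (by linarith) h2, ← measure_union]
    · congr 1
      ext c
      simp only [Set.mem_preimage, Set.mem_singleton_iff, decision, Set.mem_ofPred_eq, Set.mem_union]
      split_ifs <;> simp_all
      linarith
    · rw [Set.disjoint_left]
      intro c hc hc'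
      simp_all
    · exact measurable_decision p r trivial
  have ha : drawDecision p r .add = ENNReal.ofReal r := by
    rw [hh, ENNReal.ofReal_add h1 hr0] at hha
    exact (ENNReal.add_right_inj ENNReal.ofReal_ne_top).1 hha
  have hs : drawDecision p r .skip = ENNReal.ofReal ((1 - p) * (1 - r)) := by
    have := (drawDecision p r).tsum_coe
    rw [tsum_decision, hha, show (1 : ℝ≥0∞) = ENNReal.ofReal (p * (1 - r) + r) +
      ENNReal.ofReal ((1 - p) * (1 - r)) by
        rw [← ENNReal.ofReal_add (by linarith) (mul_nonneg (by linarith) (by linarith)),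
          ← ENNReal.ofReal_one]
        congr 1
        ring] at this
    exact (ENNReal.add_right_inj ENNReal.ofReal_ne_top).1 this
  rw [expect, tsum_decision, hh, ha, hs]

/-! ### Thinning and scanning a single list. -/

section Lists

variable {V U : Type*}

theorem expect_scan_cons (p : V × U → unitInterval) (e : V × U) (l : List (V × U))
    (F : List (V × U) × Option (V × U) → ℝ≥0∞) :
    expect (scan p (e :: l)) F = ENNReal.ofReal (p e) * F ([e], some e) +
      ENNReal.ofReal (1 - p e) * expect (scan p l) fun r => F (e :: r.1, r.2) := by
  rw [scan, expect_bind, expect_coin]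
  simp [expect_pure, expect_map]

theorem expect_scan_nil (p : V × U → unitInterval)
    (F : List (V × U) × Option (V × U) → ℝ≥0∞) : expect (scan p []) F = F ([], none) := by
  rw [scan, expect_pure]

theorem scan_support {p : V × U → unitInterval} {l : List (V × U)}
    {r : List (V × U) × Option (V × U)} (hr : r ∈ (scan p l).support) :
    (∀ e ∈ r.1, e ∈ l) ∧ ∀ e, r.2 = some e → e ∈ r.1 := by
  induction l generalizing r with
  | nil =>
    simp only [scan, PMF.support_pure, Set.mem_singleton_iff] at hr
    simp [hr]
  | cons f l ih =>
    simp only [scan, PMF.mem_support_bind_iff] at hr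
    obtain ⟨b, -, hr⟩ := hr
    cases b with
    | true =>
      simp only [if_true, PMF.support_pure, Set.mem_singleton_iff] at hr
      simp [hr]
    | false =>
      simp only [Bool.false_eq_true, if_false, PMF.mem_support_map_iff] at hr
      obtain ⟨r', hr', rfl⟩ := hr
      obtain ⟨h1, h2⟩ := ih hr'
      refine ⟨fun e he => ?_, fun e he => List.mem_cons_of_mem _ (h2 e he)⟩
      rcases List.mem_cons.1 he with rfl | he
      · simp
      · exact List.mem_cons_of_mem _ (h1 e he)

theorem thin_support {p : V × U → unitInterval} {x y : V × U → ℝ} {l l' : List (V × U)}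
    (hl : l' ∈ (thin p x y l).support) : ∀ e ∈ l', e ∈ l := by
  induction l generalizing l' with
  | nil =>
    simp only [thin, PMF.support_pure, Set.mem_singleton_iff] at hl
    simp [hl]
  | cons f l ih =>
    simp only [thin, PMF.mem_support_bind_iff] at hl
    obtain ⟨d, -, hl⟩ := hl
    intro e he
    cases d with
    | halt =>
      simp only [PMF.support_pure, Set.mem_singleton_iff] at hl
      simp [hl] at he
    | add =>
      simp only [PMF.mem_support_map_iff] at hl
      obtain ⟨l', hl', rfl⟩ := hl
      rcases List.mem_cons.1 he with rfl | he
      · simp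
      · exact List.mem_cons_of_mem _ (ih hl' e he)
    | skip => exact List.mem_cons_of_mem _ (ih hl e he)

/-- Thin a list, then examine the edges of the result. -/
noncomputable def thinScan (p : V × U → unitInterval) (x y : V × U → ℝ) (l : List (V × U)) :
    PMF (List (V × U) × Option (V × U)) :=
  (thin p x y l).bind (scan p)

theorem expect_thinScan_nil (p : V × U → unitInterval) (x y : V × U → ℝ)
    (F : List (V × U) × Option (V × U) → ℝ≥0∞) :
    expect (thinScan p x y []) F = F ([], none) := by
  simp [thinScan, thin, scan, expect_pure]

theorem expect_thinScan_cons (p : V × U → unitInterval) (x y : V × U → ℝ) (e : V × U)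
    (l : List (V × U)) (h0 : 0 ≤ ratio (x e) (y e)) (h1 : ratio (x e) (y e) ≤ 1)
    (F : List (V × U) × Option (V × U) → ℝ≥0∞) :
    expect (thinScan p x y (e :: l)) F =
      ENNReal.ofReal (p e) * ENNReal.ofReal (1 - ratio (x e) (y e)) * F ([], none) +
      ENNReal.ofReal (ratio (x e) (y e)) * (ENNReal.ofReal (p e) * F ([e], some e) +
        ENNReal.ofReal (1 - p e) * expect (thinScan p x y l) fun r => F (e :: r.1, r.2)) +
      ENNReal.ofReal (1 - p e) * ENNReal.ofReal (1 - ratio (x e) (y e)) *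
        expect (thinScan p x y l) F := by
  rw [thinScan, expect_bind, thin, expect_bind, expect_drawDecision (p e).2.1 (p e).2.2 h0 h1,
    ENNReal.ofReal_mul (p e).2.1, ENNReal.ofReal_mul (sub_nonneg.2 (p e).2.2)]
  simp only [expect_pure, expect_map, expect_scan_nil, thinScan, expect_bind, expect_scan_cons,
    expect_add, expect_const_mul, expect_const]

variable [DecidableEq V] [DecidableEq U]

/-- The test function that is `H` of the proposal if `e` is not examined, and `0` otherwise. -/
def unexamined (e : V × U) (H : Option (V × U) → ℝ≥0∞) (r : List (V × U) × Option (V × U)) :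
    ℝ≥0∞ :=
  if e ∈ r.1 then 0 else H r.2

/-- The test function of the event that the proposal is `e`. -/
def proposes (e : V × U) (r : List (V × U) × Option (V × U)) : ℝ≥0∞ :=
  if r.2 = some e then 1 else 0

theorem ofReal_add_ofReal_one_sub {a : ℝ} (h0 : 0 ≤ a) (h1 : a ≤ 1) :
    ENNReal.ofReal a + ENNReal.ofReal (1 - a) = 1 := by
  rw [← ENNReal.ofReal_add h0 (sub_nonneg.2 h1)]
  simp

/-- An added e is examined at once, so only the branches `halt` and `skip` contribute. -/
theorem expect_thinScan_unexamined_self (p : V × U → unitInterval) (x y : V × U → ℝ) (e : V × U)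
    (l : List (V × U)) (h0 : 0 ≤ ratio (x e) (y e)) (h1 : ratio (x e) (y e) ≤ 1)
    (H : Option (V × U) → ℝ≥0∞) :
    expect (thinScan p x y (e :: l)) (unexamined e H) =
      ENNReal.ofReal (1 - ratio (x e) (y e)) * (ENNReal.ofReal (p e) * H none +
        ENNReal.ofReal (1 - p e) * expect (thinScan p x y l) (unexamined e H)) := by
  rw [expect_thinScan_cons _ _ _ _ _ h0 h1]
  simp [unexamined, expect_const]
  ring

/-- Passing f happens either after adding it and finding it unrealized, or by skipping it. The two
weights r(1 - p) and (1 - r)(1 - p) sum to 1 - p, so the ratio only affects what happens when the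
scan stops at f. -/
theorem expect_thinScan_unexamined_of_ne (p : V × U → unitInterval) (x y : V × U → ℝ)
    {e f : V × U} (hef : e ≠ f) (l : List (V × U)) (h0 : 0 ≤ ratio (x f) (y f))
    (h1 : ratio (x f) (y f) ≤ 1) (H : Option (V × U) → ℝ≥0∞) :
    expect (thinScan p x y (f :: l)) (unexamined e H) =
      ENNReal.ofReal (p f) * (ENNReal.ofReal (1 - ratio (x f) (y f)) * H none +
        ENNReal.ofReal (ratio (x f) (y f)) * H (some f)) +
        ENNReal.ofReal (1 - p f) * expect (thinScan p x y l) (unexamined e H) := by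
  rw [expect_thinScan_cons _ _ _ _ _ h0 h1]
  have : (fun r : List (V × U) × Option (V × U) => unexamined e H (f :: r.1, r.2)) =
      unexamined e H := by
    ext r
    simp [unexamined, hef]
  rw [this]
  have h := ofReal_add_ofReal_one_sub h0 h1
  simp only [unexamined, List.not_mem_nil, List.mem_singleton, hef, if_false]
  set T := expect (thinScan p x y l) (unexamined e H)
  calc _ = ENNReal.ofReal (p f) * (ENNReal.ofReal (1 - ratio (x f) (y f)) * H none +
        ENNReal.ofReal (ratio (x f) (y f)) * H (some f)) + ENNReal.ofReal (1 - p f) * T *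
          (ENNReal.ofReal (ratio (x f) (y f)) + ENNReal.ofReal (1 - ratio (x f) (y f))) := by ring
    _ = _ := by rw [h, mul_one]

/-- If every possible proposal other than `e` has on average the value at least `c` after thinning,
then so has the outcome on the event that `e` is not examined. -/
theorem mul_expect_unexamined_le (p : V × U → unitInterval) (x y : V × U → ℝ) (e : V × U)
    (l : List (V × U)) (h0 : ∀ f ∈ l, 0 ≤ ratio (x f) (y f)) (h1 : ∀ f ∈ l, ratio (x f) (y f) ≤ 1)
    (H : Option (V × U) → ℝ≥0∞) (c : ℝ≥0∞) (hn : c ≤ H none)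
    (hc : ∀ f ∈ l, f ≠ e → c ≤ ENNReal.ofReal (1 - ratio (x f) (y f)) * H none +
      ENNReal.ofReal (ratio (x f) (y f)) * H (some f)) :
    c * expect (thinScan p x y l) (unexamined e fun _ => 1) ≤
      expect (thinScan p x y l) (unexamined e H) := by
  induction l with
  | nil => simpa [expect_thinScan_nil, unexamined] using hn
  | cons f l ih =>
    simp only [List.forall_mem_cons] at h0 h1 hc
    have ih := ih h0.2 h1.2 hc.2
    by_cases hf : e = f
    · subst hf
      rw [expect_thinScan_unexamined_self _ _ _ _ _ h0.1 h1.1,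
        expect_thinScan_unexamined_self _ _ _ _ _ h0.1 h1.1, mul_left_comm, mul_add, mul_one,
        mul_comm c, mul_left_comm c]
      gcongr
    · rw [expect_thinScan_unexamined_of_ne _ _ _ hf _ h0.1 h1.1,
        expect_thinScan_unexamined_of_ne _ _ _ hf _ h0.1 h1.1, mul_one, mul_one, add_comm
          (ENNReal.ofReal (1 - ratio (x f) (y f))), ofReal_add_ofReal_one_sub h0.1 h1.1, mul_one,
        mul_add, mul_comm c, mul_left_comm c]
      gcongr
      exact hc.1 (Ne.symm hf)

/-- The probability that `e` is examined after thinning is at most `r_e / p_e` times the probability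
that `e` is the first realized edge of the list. -/
theorem one_le_expect_unexamined_add (p : V × U → unitInterval) (x y : V × U → ℝ) (e : V × U)
    (hp : 0 < (p e : ℝ)) (l : List (V × U)) (h0 : ∀ f ∈ l, 0 ≤ ratio (x f) (y f))
    (h1 : ∀ f ∈ l, ratio (x f) (y f) ≤ 1) :
    1 ≤ expect (thinScan p x y l) (unexamined e fun _ => 1) +
      ENNReal.ofReal (ratio (x e) (y e) / p e) * expect (scan p l) (proposes e) := by
  induction l with
  | nil => simp [expect_thinScan_nil, unexamined]
  | cons f l ih =>
    simp only [List.forall_mem_cons] at h0 h1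
    have ih := ih h0.2 h1.2
    set T := expect (thinScan p x y l) (unexamined e fun _ => 1)
    set S := expect (scan p l) (proposes e)
    set k := ENNReal.ofReal (ratio (x e) (y e) / p e) with hk
    have hpp := ofReal_add_ofReal_one_sub (p f).2.1 (p f).2.2
    have hS' : (expect (scan p l) fun r => proposes e (f :: r.1, r.2)) = S := rfl
    rw [expect_scan_cons, hS']
    by_cases hf : e = f
    · subst hf
      rw [expect_thinScan_unexamined_self _ _ _ _ _ h0.1 h1.1]
      have hkp : k * ENNReal.ofReal (p e) = ENNReal.ofReal (ratio (x e) (y e)) := by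
        rw [hk, ← ENNReal.ofReal_mul (by have := h0.1; positivity), div_mul_cancel₀ _ hp.ne']
      have hr1 : ENNReal.ofReal (1 - ratio (x e) (y e)) ≤ 1 :=
        ENNReal.ofReal_le_one.2 (by linarith [h0.1])
      calc (1 : ℝ≥0∞) = ENNReal.ofReal (1 - ratio (x e) (y e)) * (ENNReal.ofReal (p e) * 1 +
            ENNReal.ofReal (1 - p e) * 1) + ENNReal.ofReal (ratio (x e) (y e)) := by
            rw [mul_one, mul_one, hpp, mul_one, add_comm, ofReal_add_ofReal_one_sub h0.1 h1.1]
        _ ≤ ENNReal.ofReal (1 - ratio (x e) (y e)) * (ENNReal.ofReal (p e) * 1 +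
            ENNReal.ofReal (1 - p e) * (T + k * S)) + k * ENNReal.ofReal (p e) := by
            rw [hkp]
            gcongr
        _ = ENNReal.ofReal (1 - ratio (x e) (y e)) * (ENNReal.ofReal (p e) * 1 +
            ENNReal.ofReal (1 - p e) * T) + k * (ENNReal.ofReal (p e) * 1 +
            ENNReal.ofReal (1 - ratio (x e) (y e)) * (ENNReal.ofReal (1 - p e) * S)) := by ring
        -- Bounding the factor by `1` covers a further occurrence of e in the tail; without one, `S`
        -- vanishes.
        _ ≤ ENNReal.ofReal (1 - ratio (x e) (y e)) * (ENNReal.ofReal (p e) * 1 +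
            ENNReal.ofReal (1 - p e) * T) + k * (ENNReal.ofReal (p e) * 1 +
            1 * (ENNReal.ofReal (1 - p e) * S)) := by gcongr
        _ = _ := by simp [proposes, T]
    · rw [expect_thinScan_unexamined_of_ne _ _ _ hf _ h0.1 h1.1]
      have : proposes e ([f], some f) = 0 := by simp [proposes, Ne.symm hf]
      rw [this, mul_one, mul_one, add_comm (ENNReal.ofReal (1 - ratio (x f) (y f))),
        ofReal_add_ofReal_one_sub h0.1 h1.1]
      calc (1 : ℝ≥0∞) = ENNReal.ofReal (p f) * 1 + ENNReal.ofReal (1 - p f) * 1 := by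
            rw [mul_one, mul_one, hpp]
        _ ≤ ENNReal.ofReal (p f) * 1 + ENNReal.ofReal (1 - p f) * (T + k * S) := by gcongr
        _ = _ := by ring

/-- Thinning scales the probability of every proposal by the ratio of that edge. -/
theorem expect_thinScan_proposes (p : V × U → unitInterval) (x y : V × U → ℝ) (e : V × U)
    (l : List (V × U)) (h0 : ∀ f ∈ l, 0 ≤ ratio (x f) (y f))
    (h1 : ∀ f ∈ l, ratio (x f) (y f) ≤ 1) :
    expect (thinScan p x y l) (proposes e) =
      ENNReal.ofReal (ratio (x e) (y e)) * expect (scan p l) (proposes e) := by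
  induction l with
  | nil => simp [expect_thinScan_nil, proposes, scan, expect_pure]
  | cons f l ih =>
    simp only [List.forall_mem_cons] at h0 h1
    have ih := ih h0.2 h1.2
    have hr := ofReal_add_ofReal_one_sub h0.1 h1.1
    rw [expect_thinScan_cons _ _ _ _ _ h0.1 h1.1, expect_scan_cons]
    have hS : (expect (scan p l) fun r => proposes e (f :: r.1, r.2)) =
      expect (scan p l) (proposes e) := rfl
    have hT : (expect (thinScan p x y l) fun r => proposes e (f :: r.1, r.2)) =
      expect (thinScan p x y l) (proposes e) := rfl
    have hn : proposes e (([] : List (V × U)), none) = 0 := by simp [proposes]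
    rw [hS, hT, hn, ih]
    set S := expect (scan p l) (proposes e)
    set k := ENNReal.ofReal (ratio (x e) (y e)) with hk
    calc _ = ENNReal.ofReal (ratio (x f) (y f)) * (ENNReal.ofReal (p f) *
          proposes e ([f], some f)) + ENNReal.ofReal (1 - p f) * (k * S) *
          (ENNReal.ofReal (ratio (x f) (y f)) + ENNReal.ofReal (1 - ratio (x f) (y f))) := by ring
      _ = k * (ENNReal.ofReal (p f) * proposes e ([f], some f)) +
          ENNReal.ofReal (1 - p f) * (k * S) := by
          rw [hr, mul_one]
          by_cases hf : e = f
          · rw [hk, hf]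
          · simp [proposes, Ne.symm hf]
      _ = _ := by ring

end Lists

/-! ### Runs along a fixed order. -/

section Dynamics

variable {V U : Type*} [DecidableEq V] [DecidableEq U]

/-- The state after a vertex whose turn has the outcome `r`. -/
def step (s : State V U) (r : List (V × U) × Option (V × U)) : State V U :=
  ⟨s.examined ∪ r.1.toFinset, propose s.matching r.2⟩

/-- The law of the list of examined edges and the proposal in the turn of one vertex. -/
noncomputable def outcome (p : V × U → unitInterval) (x y : V × U → ℝ) (D : PMF (List (V × U))) :
    PMF (List (V × U) × Option (V × U)) :=
  D.bind (thinScan p x y)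

/-- Separates the randomness of a turn, whose law does not depend on the state, from its
deterministic effect on the state. -/
theorem turn_eq (p : V × U → unitInterval) (x y : V × U → ℝ) (D : PMF (List (V × U)))
    (s : State V U) : turn p x y D s = (outcome p x y D).map (step s) := by
  rw [turn, outcome, PMF.bind_bind]
  rfl

theorem turns_append (p : V × U → unitInterval) (x y : V × U → ℝ) (D : V → PMF (List (V × U)))
    (l l' : List V) (s : State V U) :
    turns p x y D (l ++ l') s = (turns p x y D l s).bind (turns p x y D l') := by
  induction l generalizing s with
  | nil => simp [turns]
  | cons w l ih =>
    simp only [List.cons_append, turns, PMF.bind_bind]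
    congr 1
    ext1 t
    rw [ih]

/-- The outcomes of a turn of `w`: only edges at `w` are examined, and only an examined edge can be
proposed. -/
def IsOutcome (E : Finset (V × U)) (w : V) (r : List (V × U) × Option (V × U)) : Prop :=
  (∀ f ∈ r.1, f ∈ E ∧ f.1 = w) ∧ ∀ f, r.2 = some f → f ∈ r.1

theorem isOutcome_of_mem_support {p : V × U → unitInterval} {x y : V × U → ℝ}
    {D : PMF (List (V × U))} {E : Finset (V × U)} {w : V}
    (hD : ∀ l ∈ D.support, ∀ f ∈ l, f ∈ E ∧ f.1 = w) {r : List (V × U) × Option (V × U)}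
    (hr : r ∈ (outcome p x y D).support) : IsOutcome E w r := by
  simp only [outcome, thinScan, PMF.mem_support_bind_iff] at hr
  obtain ⟨l, hl, l', hl', hr⟩ := hr
  exact ⟨fun f hf => hD l hl f (thin_support hl' f ((scan_support hr).1 f hf)), (scan_support hr).2⟩

/-- The edge `e` is not examined, and no edge of the matching shares an end-point with it. -/
def Free (e : V × U) (s : State V U) : Prop :=
  e ∉ s.examined ∧ ∀ m ∈ s.matching, m.1 ≠ e.1 ∧ m.2 ≠ e.2

/-- The vertex `u` is matched. -/
def Matched (u : U) (s : State V U) : Prop := ∃ m ∈ s.matching, m.2 = u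

theorem propose_subset (M : Finset (V × U)) (o : Option (V × U)) : M ⊆ propose M o := by
  cases o with
  | none => simp [propose]
  | some f =>
    simp only [propose]
    split_ifs
    · exact Finset.subset_insert _ _
    · exact subset_rfl

theorem mem_propose {M : Finset (V × U)} {o : Option (V × U)} {m : V × U}
    (hm : m ∈ propose M o) : m ∈ M ∨ o = some m := by
  cases o with
  | none => exact Or.inl hm
  | some f =>
    simp only [propose] at hm
    split_ifs at hm
    · rcases Finset.mem_insert.1 hm with rfl | h
      · exact Or.inr rfl
      · exact Or.inl h
    · exact Or.inl hm

theorem Matched.step {u : U} {s : State V U} (h : Matched u s)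
    (r : List (V × U) × Option (V × U)) : Matched u (step s r) := by
  obtain ⟨m, hm, hu⟩ := h
  exact ⟨m, propose_subset _ _ hm, hu⟩

theorem matched_step_some (s : State V U) {r : List (V × U) × Option (V × U)} {f : V × U}
    (hr : r.2 = some f) : Matched f.2 (step s r) := by
  simp only [Matched, step, hr, propose]
  split_ifs with h
  · exact ⟨f, by simp, rfl⟩
  · push Not at h
    exact h

/-- A vertex other than the left end-point of e examines only its own edges, so it can spoil e only
by taking the right end-point. -/
theorem Free.step {e : V × U} {s : State V U} (h : Free e s) {E : Finset (V × U)} {w : V}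
    (hw : w ≠ e.1) {r : List (V × U) × Option (V × U)} (hr : IsOutcome E w r)
    (hne : r.2 ≠ some (w, e.2)) : Free e (step s r) := by
  constructor
  · intro he
    rcases Finset.mem_union.1 he with he | he
    · exact h.1 he
    · exact hw ((hr.1 e (List.mem_toFinset.1 he)).2.symm)
  · intro m hm
    rcases mem_propose hm with hm | hm
    · exact h.2 m hm
    · have hmw := (hr.1 m (hr.2 m hm)).2
      refine ⟨hmw ▸ hw, fun hu => hne ?_⟩
      rw [hm, ← hmw, ← hu]

theorem Free.step_self_none {e : V × U} {s : State V U} (h : Free e s)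
    {r : List (V × U) × Option (V × U)} (he : e ∉ r.1) (hr : r.2 = none) :
    Free e (StochasticMatching.step s r) := by
  constructor
  · simp [StochasticMatching.step, h.1, he]
  · intro m hm
    rw [StochasticMatching.step, hr] at hm
    exact h.2 m hm

theorem Free.step_self_some {e : V × U} {s : State V U} (h : Free e s)
    {r : List (V × U) × Option (V × U)} (he : e ∉ r.1) {f : V × U} (hr : r.2 = some f)
    (hf : Matched f.2 s) : Free e (StochasticMatching.step s r) := by
  constructor
  · simp [StochasticMatching.step, h.1, he]
  · intro m hm
    obtain ⟨m', hm', hu⟩ := hf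
    have : ¬ ∀ m ∈ s.matching, m.2 ≠ f.2 := fun h' => h' m' hm' hu
    rw [StochasticMatching.step, hr, propose, if_neg this] at hm
    exact h.2 m hm

/-- The probability that none of the vertices in a list proposes to `u`, if `w` proposes to `u` with
probability `q w u`, independently. -/
def noProposal (q : V → U → ℝ) (u : U) (l : List V) : ℝ := (l.map fun w => 1 - q w u).prod

theorem noProposal_nonneg {q : V → U → ℝ} {u : U} (h : ∀ w, q w u ≤ 1) (l : List V) :
    0 ≤ noProposal q u l :=
  List.prod_nonneg (by simpa using fun w _ => h w)

theorem noProposal_le_one {q : V → U → ℝ} {u : U} (h0 : ∀ w, 0 ≤ q w u) (h : ∀ w, q w u ≤ 1)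
    (l : List V) : noProposal q u l ≤ 1 := by
  induction l with
  | nil => simp [noProposal]
  | cons w l ih =>
    have := noProposal_nonneg h l
    simp only [noProposal, List.map_cons, List.prod_cons] at this ih ⊢
    nlinarith [h0 w, h w]

/-- What the analysis of a run uses about the turns: which outcomes are possible for each vertex, and
with what probability a vertex `w` proposes to `u`. -/
structure HasProposalLaw (p : V × U → unitInterval) (x y : V × U → ℝ) (D : V → PMF (List (V × U)))
    (E : Finset (V × U)) (q : V → U → ℝ) : Prop where
  isOutcome : ∀ w, ∀ r ∈ (outcome p x y (D w)).support, IsOutcome E w r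
  nonneg : ∀ w u, 0 ≤ q w u
  le_one : ∀ w u, q w u ≤ 1
  prob : ∀ w u, expect (outcome p x y (D w)) (proposes (w, u)) = ENNReal.ofReal (q w u)

variable {p : V × U → unitInterval} {x y : V × U → ℝ} {D : V → PMF (List (V × U))}
  {E : Finset (V × U)} {q : V → U → ℝ}

theorem expect_turns_cons (w : V) (l : List V) (s : State V U) (F : State V U → ℝ≥0∞) :
    expect (turns p x y D (w :: l) s) F =
      expect (outcome p x y (D w)) fun r => expect (turns p x y D l (step s r)) F := by
  rw [turns, expect_bind, turn_eq, expect_map]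

theorem HasProposalLaw.le_expect (h : HasProposalLaw p x y D E q) (w : V) (u : U) {a : ℝ}
    (ha : 0 ≤ a) {F : List (V × U) × Option (V × U) → ℝ≥0∞}
    (hF : ∀ r, IsOutcome E w r → r.2 ≠ some (w, u) → ENNReal.ofReal a ≤ F r) :
    ENNReal.ofReal ((1 - q w u) * a) ≤ expect (outcome p x y (D w)) F := by
  -- The bound is proved in additive form because subtraction in `ℝ≥0∞` is truncated.
  have h1 : ENNReal.ofReal a ≤ expect (outcome p x y (D w)) F +
      ENNReal.ofReal (q w u) * ENNReal.ofReal a := by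
    rw [← h.prob, ← expect_mul_const, ← expect_add]
    conv_lhs => rw [← expect_const (outcome p x y (D w)) (ENNReal.ofReal a)]
    refine expect_mono fun r hr => ?_
    by_cases hu : r.2 = some (w, u)
    · simp [proposes, hu]
    · simpa [proposes, hu] using hF r (h.isOutcome w r hr) hu
  rw [sub_mul, one_mul, ENNReal.ofReal_sub _ (mul_nonneg (h.nonneg w u) ha), ENNReal.ofReal_mul (h.nonneg w u)]
  exact tsub_le_iff_right.2 h1

/-- One turn makes at most one proposal, so proposals to u and to u' are disjoint events and their
probabilities add. -/
theorem HasProposalLaw.le_expect_two (h : HasProposalLaw p x y D E q) (w : V) {u u' : U}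
    (huu : u' ≠ u) {a b : ℝ} (ha : 0 ≤ a) (hb : 0 ≤ b)
    {F : List (V × U) × Option (V × U) → ℝ≥0∞}
    (hFa : ∀ r, IsOutcome E w r → r.2 = some (w, u') → ENNReal.ofReal a ≤ F r)
    (hFb : ∀ r, IsOutcome E w r → r.2 ≠ some (w, u) → r.2 ≠ some (w, u') → ENNReal.ofReal b ≤ F r) :
    ENNReal.ofReal (q w u' * a + (1 - q w u - q w u') * b) ≤ expect (outcome p x y (D w)) F := by
  have h1 : ENNReal.ofReal (b + q w u' * a) ≤ expect (outcome p x y (D w)) F +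
      ENNReal.ofReal ((q w u + q w u') * b) := by
    rw [ENNReal.ofReal_add hb (mul_nonneg (h.nonneg _ _) ha),
      ENNReal.ofReal_mul (add_nonneg (h.nonneg _ _) (h.nonneg _ _)),
      ENNReal.ofReal_mul (h.nonneg _ _), ENNReal.ofReal_add (h.nonneg _ _) (h.nonneg _ _),
      ← h.prob, ← h.prob, ← expect_add, ← expect_mul_const, ← expect_mul_const, ← expect_add]
    conv_lhs => rw [← expect_const (outcome p x y (D w)) (ENNReal.ofReal b)]
    rw [← expect_add]
    refine expect_mono fun r hr => ?_
    by_cases hu : r.2 = some (w, u)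
    · simp [proposes, hu, Ne.symm huu]
    · by_cases hu' : r.2 = some (w, u')
      · have := hFa r (h.isOutcome w r hr) hu'
        simp only [proposes, hu', Option.some.injEq, Prod.mk.injEq, true_and, huu, if_true, if_false,
          one_mul, zero_add]
        rw [add_comm]
        gcongr
      · simpa [proposes, hu, hu'] using hFb r (h.isOutcome w r hr) hu hu'
  have hr : q w u' * a + (1 - q w u - q w u') * b = b + q w u' * a - (q w u + q w u') * b := by ring
  rw [hr, ENNReal.ofReal_sub _ (mul_nonneg (add_nonneg (h.nonneg _ _) (h.nonneg _ _)) hb)]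
  exact tsub_le_iff_right.2 h1

/-- `J` stands for any property that persists along a run; it is applied with `True` and with
`Matched u`. -/
theorem HasProposalLaw.le_expect_turns (h : HasProposalLaw p x y D E q) (e : V × U)
    (J : State V U → Prop) (hJ : ∀ s r, J s → J (step s r)) (l : List V) (hl : e.1 ∉ l)
    {s : State V U} (hs : Free e s) (hsJ : J s) :
    ENNReal.ofReal (noProposal q e.2 l) ≤
      expect (turns p x y D l s) ({s | Free e s ∧ J s}.indicator 1) := by
  induction l generalizing s with
  | nil => simp [noProposal, turns, expect_pure, hs, hsJ]
  | cons w l ih =>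
    simp only [List.mem_cons, not_or] at hl
    rw [expect_turns_cons, noProposal, List.map_cons, List.prod_cons]
    exact h.le_expect w e.2 (noProposal_nonneg (fun w => h.le_one w e.2) l) fun r hr hne => ih hl.2 (hs.step (Ne.symm hl.1) hr hne) (hJ s r hsJ)

/-- The product bound holds although the two events are dependent: since a vertex cannot propose to
both right vertices, avoiding `e.2` only helps `u` to get a proposal. -/
theorem HasProposalLaw.le_expect_turns_matched (h : HasProposalLaw p x y D E q) (e : V × U)
    {u : U} (hu : u ≠ e.2) (l : List V) (hl : e.1 ∉ l) {s : State V U} (hs : Free e s) :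
    ENNReal.ofReal (noProposal q e.2 l * (1 - noProposal q u l)) ≤
      expect (turns p x y D l s) ({s | Free e s ∧ Matched u s}.indicator 1) := by
  induction l generalizing s with
  | nil => simp [noProposal]
  | cons w l ih =>
    simp only [List.mem_cons, not_or] at hl
    have hN := noProposal_nonneg (fun w => h.le_one w e.2) l
    have hR0 := noProposal_nonneg (fun w => h.le_one w u) l
    have hR := noProposal_le_one (fun w => h.nonneg w u) (fun w => h.le_one w u) l
    rw [expect_turns_cons]
    refine le_trans ?_ (h.le_expect_two w hu hN (mul_nonneg hN (sub_nonneg.2 hR)) ?_ ?_)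
    · refine ENNReal.ofReal_le_ofReal ?_
      have h1 : noProposal q e.2 (w :: l) = (1 - q w e.2) * noProposal q e.2 l := rfl
      have h2 : noProposal q u (w :: l) = (1 - q w u) * noProposal q u l := rfl
      rw [h1, h2]
      -- The slack is exactly q(w, e.2) q(w, u) N R, where N and R are the products over the tail
      -- for `e.2` and for `u`.
      have := mul_nonneg (mul_nonneg (mul_nonneg (h.nonneg w e.2) (h.nonneg w u)) hN) hR0
      nlinarith
    · intro r hr hru
      refine h.le_expect_turns e (Matched u) (fun s r hm => hm.step r) l hl.2
        (hs.step (Ne.symm hl.1) hr ?_) (matched_step_some s hru)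
      rw [hru]
      simpa using hu
    · intro r hr hne _
      exact ih hl.2 (hs.step (Ne.symm hl.1) hr hne)

/-- The lower bound, given the outcome of the turn of `v`, for the probability that an edge `(v, u)` is
available: nobody proposes to `u`, and if `v` proposes along `f`, then somebody has proposed to the
other end-point of `f` before. -/
noncomputable def outcomeValue (q : V → U → ℝ) (u : U) (l l' : List V) :
    Option (V × U) → ℝ≥0∞
  | none => ENNReal.ofReal (noProposal q u l * noProposal q u l')
  | some f => ENNReal.ofReal (noProposal q u l * noProposal q u l' * (1 - noProposal q f.2 l))

/-- The turns before v, the turn of v and the turns after v must each keep e free. If v proposes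
along f, the turns before v must also have matched `f.2`, so that the proposal is rejected. -/
theorem HasProposalLaw.expect_outcomeValue_le (h : HasProposalLaw p x y D E q) (e : V × U)
    (l l' : List V) (hl : e.1 ∉ l) (hl' : e.1 ∉ l') :
    expect (outcome p x y (D e.1)) (unexamined e (outcomeValue q e.2 l l')) ≤
      expect (turns p x y D (l ++ e.1 :: l') ⟨∅, ∅⟩) ({s | Free e s}.indicator 1) := by
  have hs0 : Free e (⟨∅, ∅⟩ : State V U) := by simp [Free]
  have hN' := noProposal_nonneg (fun w => h.le_one w e.2) l'
  have hlate {s : State V U} (hs : Free e s) : ENNReal.ofReal (noProposal q e.2 l') ≤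
      expect (turns p x y D l' s) ({s | Free e s}.indicator 1) := by
    simpa using h.le_expect_turns e (fun _ => True) (fun _ _ _ => trivial) l' hl' hs trivial
  rw [turns_append, expect_bind]
  simp_rw [expect_turns_cons]
  -- The outcome of v may be drawn before the earlier turns, as its law does not depend on the
  -- state.
  rw [expect_comm]
  refine expect_mono fun r hr => ?_
  have hr' := h.isOutcome _ r hr
  unfold unexamined
  split_ifs with he
  · exact zero_le
  cases hr2 : r.2 with
  | none =>
    calc outcomeValue q e.2 l l' none
        ≤ expect (turns p x y D l ⟨∅, ∅⟩) ({s | Free e s ∧ True}.indicator 1) *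
          ENNReal.ofReal (noProposal q e.2 l') := by
          rw [outcomeValue, ENNReal.ofReal_mul' hN']
          gcongr
          exact h.le_expect_turns e (fun _ => True) (fun _ _ _ => trivial) l hl hs0 trivial
      _ ≤ _ := by
          rw [← expect_mul_const]
          refine expect_mono fun s _ => ?_
          by_cases hs : Free e s
          · simpa [hs] using hlate (hs.step_self_none he hr2)
          · simp [hs]
  | some f =>
    have hfr := hr'.2 f hr2
    have hf1 := (hr'.1 f hfr).2
    -- Otherwise f = e, which would then be examined.
    have hf2 : f.2 ≠ e.2 := fun h2 => he (by rwa [← Prod.ext hf1 h2])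
    calc outcomeValue q e.2 l l' (some f)
        ≤ expect (turns p x y D l ⟨∅, ∅⟩) ({s | Free e s ∧ Matched f.2 s}.indicator 1) *
          ENNReal.ofReal (noProposal q e.2 l') := by
          rw [outcomeValue, mul_right_comm, ENNReal.ofReal_mul' hN']
          gcongr
          exact h.le_expect_turns_matched e hf2 l hl hs0
      _ ≤ _ := by
          rw [← expect_mul_const]
          refine expect_mono fun s _ => ?_
          by_cases hs : Free e s ∧ Matched f.2 s
          · simpa [hs] using hlate (hs.1.step_self_some he hr2 hs.2)
          · simp [hs]

/-! ### Averaging over the random order. -/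

variable [Fintype V]

theorem expect_randomOrder (F : List V → ℝ≥0∞) :
    expect (randomOrder V) F = ∑ π : Fin (Fintype.card V) ≃ V,
      (Fintype.card (Fin (Fintype.card V) ≃ V) : ℝ≥0∞)⁻¹ * F (List.ofFn π) := by
  have : Nonempty (Fin (Fintype.card V) ≃ V) := ⟨(Fintype.equivFin V).symm⟩
  have : randomOrder V = (PMF.uniformOfFintype (Fin (Fintype.card V) ≃ V)).bind fun π =>
      PMF.pure (List.ofFn π) := by
    change ((PMF.uniformOfFintype (Fin (Fintype.card V) ≃ V)).bind
      fun π => PMF.pure (π : Fin (Fintype.card V) → V)).map List.ofFn = _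
    simp [PMF.map_bind, PMF.pure_map]
  rw [this, expect_bind]
  simp only [expect_pure]
  simp only [expect, PMF.uniformOfFintype_apply, tsum_fintype]

theorem reverse_ofFn {n : ℕ} {α : Type*} (f : Fin n → α) :
    (List.ofFn f).reverse = List.ofFn fun i => f i.rev := by
  refine List.ext_getElem (by simp) fun i h1 h2 => ?_
  simp only [List.getElem_reverse, List.getElem_ofFn, List.length_ofFn]
  congr 1
  ext
  simp only [Fin.val_rev]
  omega

/-- Besides the fact that an order lists every vertex once, this symmetry is all that is needed of
the uniform distribution. -/
theorem expect_randomOrder_reverse (F : List V → ℝ≥0∞) :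
    (expect (randomOrder V) fun l => F l.reverse) = expect (randomOrder V) F := by
  rw [expect_randomOrder, expect_randomOrder, ← Equiv.sum_comp
    (Equiv.equivCongr Fin.revPerm (Equiv.refl V))]
  refine Finset.sum_congr rfl fun π _ => ?_
  rw [reverse_ofFn]
  congr 3
  ext i
  simp [Equiv.equivCongr]

theorem mem_support_randomOrder {l : List V} (hl : l ∈ (randomOrder V).support) :
    l.Nodup ∧ ∀ v, v ∈ l := by
  classical
  by_contra hcon
  have h0 : expect (randomOrder V) (({l} : Set (List V)).indicator 1) = 0 := by
    rw [expect_randomOrder]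
    refine Finset.sum_eq_zero fun π _ => ?_
    have : List.ofFn π ≠ l := by
      rintro rfl
      exact hcon ⟨List.nodup_ofFn.2 π.injective, fun v => List.mem_ofFn.2 (π.surjective v)⟩
    simp [this]
  rw [expect_single] at h0
  exact hl h0

/-- The value of `outcomeValue` on average over an order and its reverse. -/
noncomputable def meanValue (q : V → U → ℝ) (v : V) (u : U) : Option (V × U) → ℝ≥0∞
  | none => ENNReal.ofReal (∏ w ∈ Finset.univ.erase v, (1 - q w u))
  | some f => ENNReal.ofReal ((∏ w ∈ Finset.univ.erase v, (1 - q w u)) *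
      ((1 - ∏ w ∈ Finset.univ.erase v, (1 - q w f.2)) / 2))

theorem noProposal_mul_noProposal (q : V → U → ℝ) (u : U) {v : V} {l l' : List V}
    (hnd : (l ++ v :: l').Nodup) (hmem : ∀ w, w ∈ l ++ v :: l') :
    noProposal q u l * noProposal q u l' = ∏ w ∈ Finset.univ.erase v, (1 - q w u) := by
  have hnd' := List.nodup_middle.1 hnd
  rw [List.nodup_cons] at hnd'
  have : Finset.univ.erase v = (l ++ l').toFinset := by
    ext w
    have := hmem w
    simp only [Finset.mem_erase, Finset.mem_univ, and_true, List.mem_toFinset]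
    constructor
    · intro hw
      simp_all
    · rintro hw rfl
      exact hnd'.1 hw
  rw [this, List.prod_toFinset _ hnd'.2, List.map_append, List.prod_append]
  rfl

/-- Reversal swaps the vertices before and after v. With a and b the no-proposal probabilities of
the two sides, (1 - a) + (1 - b) ≥ 1 - ab, where ab no longer depends on the order. -/
theorem HasProposalLaw.expect_meanValue_le (h : HasProposalLaw p x y D E q) (e : V × U) :
    expect (outcome p x y (D e.1)) (unexamined e (meanValue q e.1 e.2)) ≤
      expect (randomOrder V) fun l => expect (turns p x y D l ⟨∅, ∅⟩)
        ({s | Free e s}.indicator 1) := by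
  set G : List V → ℝ≥0∞ := fun l => expect (turns p x y D l ⟨∅, ∅⟩) ({s | Free e s}.indicator 1)
  set T := expect (outcome p x y (D e.1)) (unexamined e (meanValue q e.1 e.2))
  have h2 : 2 * T ≤ 2 * expect (randomOrder V) G := by
    calc 2 * T = expect (randomOrder V) fun _ => 2 * T := (expect_const _ _).symm
      _ ≤ expect (randomOrder V) fun l => G l + G l.reverse := by
          refine expect_mono fun o ho => ?_
          obtain ⟨hnd, hmem⟩ := mem_support_randomOrder ho
          obtain ⟨l, l', rfl⟩ := List.append_of_mem (hmem e.1)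
          have hnd' := List.nodup_cons.1 (List.nodup_middle.1 hnd)
          simp only [List.mem_append, not_or] at hnd'
          have h1 := h.expect_outcomeValue_le e l l' hnd'.1.1 hnd'.1.2
          have h2 := h.expect_outcomeValue_le e l'.reverse l.reverse
            (by simpa using hnd'.1.2) (by simpa using hnd'.1.1)
          have hrev : (l ++ e.1 :: l').reverse = l'.reverse ++ e.1 :: l.reverse := by simp
          rw [hrev]
          refine le_trans ?_ (add_le_add h1 h2)
          rw [← expect_add, ← expect_const_mul]
          refine expect_mono fun r _ => ?_
          unfold unexamined
          split_ifs
          · simp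
          have hnr (u : U) (l : List V) : noProposal q u l.reverse = noProposal q u l := by
            simp [noProposal, List.prod_reverse]
          have hm (u : U) := noProposal_mul_noProposal q u hnd hmem
          cases r.2 with
          | none =>
            simp only [meanValue, outcomeValue, hnr, hm, mul_comm (noProposal q e.2 l')]
            rw [two_mul]
          | some f =>
            simp only [meanValue, outcomeValue, hnr, hm, mul_comm (noProposal q e.2 l')]
            have hN : 0 ≤ ∏ w ∈ Finset.univ.erase e.1, (1 - q w e.2) :=
              Finset.prod_nonneg fun w _ => sub_nonneg.2 (h.le_one w e.2)
            have ha := noProposal_le_one (fun w => h.nonneg w f.2) (fun w => h.le_one w f.2) l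
            have hb := noProposal_le_one (fun w => h.nonneg w f.2) (fun w => h.le_one w f.2) l'
            rw [← ENNReal.ofReal_add (mul_nonneg hN (sub_nonneg.2 ha))
              (mul_nonneg hN (sub_nonneg.2 hb)), ← ENNReal.ofReal_ofNat 2,
              ← ENNReal.ofReal_mul (by norm_num), ← hm f.2]
            refine ENNReal.ofReal_le_ofReal ?_
            nlinarith [mul_nonneg hN (mul_nonneg (sub_nonneg.2 ha) (sub_nonneg.2 hb))]
      _ = 2 * expect (randomOrder V) G := by
          rw [expect_add, expect_randomOrder_reverse, two_mul]
  exact (ENNReal.mul_le_mul_iff_right (by norm_num) (by norm_num)).1 h2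

end Dynamics

/-! ### Inequalities for g. -/

section Analysis

open Real

theorem exp_lt_chord_pos {x : ℝ} (hx : x < 1) : 0 < exp 1 - exp x :=
  sub_pos.2 (exp_lt_exp.2 hx)

theorem g_one_one : g 1 1 = 1 - exp (-1) := by simp [g]

theorem g_of_lt {x : ℝ} (hx : x < 1) :
    g x 1 = (exp 1 - 1) * (1 - x) * x / (exp 1 - exp x) := by
  simp [g, hx.ne]

theorem exp_one_sub_one_pos : 0 < exp 1 - 1 := by linarith [add_one_lt_exp one_ne_zero]

/-- The ratio `g(x) / x`, as a function of `x ∈ [0, 1]`. -/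
theorem ratio_g_of_lt {x : ℝ} (hx : x < 1) :
    ratio x (g x 1) = (exp 1 - 1) * (1 - x) / (exp 1 - exp x) := by
  unfold ratio
  split_ifs with h
  · subst h
    simp [exp_one_sub_one_pos.ne']
  · rw [g_of_lt hx]
    field_simp

theorem ratio_g_one : ratio 1 (g 1 1) = 1 - exp (-1) := by simp [ratio, g_one_one]

theorem ratio_mul_self (x : ℝ) : ratio x (g x 1) * x = g x 1 := by
  unfold ratio
  split_ifs with h
  · subst h
    simp [g]
  · exact div_mul_cancel₀ _ h

theorem ratio_g_nonneg {x : ℝ} (h1 : x ≤ 1) : 0 ≤ ratio x (g x 1) := by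
  rcases h1.eq_or_lt with rfl | h
  · rw [ratio_g_one]
    have : exp (-1) ≤ 1 := exp_le_one_iff.2 (by norm_num)
    linarith
  · rw [ratio_g_of_lt h]
    have := exp_lt_chord_pos h
    have := exp_one_sub_one_pos
    have : 0 < 1 - x := by linarith
    positivity

/-- `(1 - 1/e) / 2`. -/
theorem half_eq : (1 - 1 / exp 1) / 2 * (2 * exp 1) = exp 1 - 1 := by
  have := exp_pos 1
  field_simp

theorem three_mul_half_le : 3 * ((1 - 1 / exp 1) / 2) ≤ 1 := by
  have h := half_eq
  have := exp_one_lt_d9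
  have := exp_pos 1
  nlinarith

theorem half_pos : 0 < (1 - 1 / exp 1) / 2 := by
  have h := half_eq
  have := exp_one_sub_one_pos
  have := exp_pos 1
  by_contra hc
  nlinarith

/-- Concavity of `(1 - c x) (e - e^x) - (e - 1) (1 - x)` for `c = (1 - 1/e) / 2`, which vanishes at both
ends of `[0, 1]`. -/
theorem chord_bound {x : ℝ} (h0 : 0 ≤ x) (h1 : x ≤ 1) :
    (exp 1 - 1) * (1 - x) ≤ (1 - (1 - 1 / exp 1) / 2 * x) * (exp 1 - exp x) := by
  have hc3 := three_mul_half_le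
  have hc0 := half_pos
  set c := (1 - 1 / exp 1) / 2
  have hcc : ConcaveOn ℝ (Set.Icc (0 : ℝ) 1)
      fun x => (1 - c * x) * (exp 1 - exp x) - (exp 1 - 1) * (1 - x) := by
    have hd (x : ℝ) : HasDerivAt (fun x => (1 - c * x) * (exp 1 - exp x) - (exp 1 - 1) * (1 - x))
        (-c * (exp 1 - exp x) - (1 - c * x) * exp x + (exp 1 - 1)) x := by
      have h1 : HasDerivAt (fun x : ℝ => 1 - c * x) (-c) x := by
        simpa using ((hasDerivAt_id x).const_mul c).const_sub 1
      have h2 : HasDerivAt (fun x : ℝ => exp 1 - exp x) (-exp x) x :=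
        (Real.hasDerivAt_exp x).const_sub _
      have h3 : HasDerivAt (fun x : ℝ => (exp 1 - 1) * (1 - x)) (-(exp 1 - 1)) x := by
        simpa using ((hasDerivAt_id x).const_sub 1).const_mul (exp 1 - 1)
      exact ((h1.mul h2).sub h3).congr_deriv (by ring)
    have hd2 (x : ℝ) : HasDerivAt
        (fun x => -c * (exp 1 - exp x) - (1 - c * x) * exp x + (exp 1 - 1))
        (exp x * (2 * c - 1 + c * x)) x := by
      have h1 : HasDerivAt (fun x : ℝ => 1 - c * x) (-c) x := by
        simpa using ((hasDerivAt_id x).const_mul c).const_sub 1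
      have h2 : HasDerivAt (fun x : ℝ => exp 1 - exp x) (-exp x) x :=
        (Real.hasDerivAt_exp x).const_sub _
      exact (((h2.const_mul (-c)).sub (h1.mul (Real.hasDerivAt_exp x))).add_const
        (exp 1 - 1)).congr_deriv (by ring)
    refine concaveOn_of_hasDerivWithinAt2_nonpos (convex_Icc 0 1)
      (fun x _ => (hd x).continuousAt.continuousWithinAt)
      (fun x _ => (hd x).hasDerivWithinAt) (fun x _ => (hd2 x).hasDerivWithinAt) ?_
    intro x hx
    rw [interior_Icc] at hx
    -- Uses x ≤ 1 and 3c ≤ 1, which amounts to `exp 1` ≤ 3.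
    have : 2 * c - 1 + c * x ≤ 0 := by nlinarith [hx.2]
    exact mul_nonpos_of_nonneg_of_nonpos (exp_pos x).le this
  have := hcc.2 (x := 0) (y := 1) (by simp) (by simp) (sub_nonneg.2 h1) h0 (by ring)
  simp at this
  linarith

theorem ratio_g_le {x : ℝ} (h0 : 0 ≤ x) (h1 : x ≤ 1) :
    ratio x (g x 1) ≤ 1 - (1 - 1 / exp 1) / 2 * x := by
  rcases h1.eq_or_lt with rfl | h
  · rw [ratio_g_one, exp_neg, one_div]
    have := inv_le_one_of_one_le₀ (one_le_exp zero_le_one)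
    have : 1 ≤ 3 * (exp 1)⁻¹ := by
      have := exp_pos 1
      have := exp_one_lt_d9
      rw [← div_eq_mul_inv, le_div_iff₀ (by positivity)]
      linarith
    linarith
  · rw [ratio_g_of_lt h, div_le_iff₀ (exp_lt_chord_pos h)]
    exact chord_bound h0 h1

theorem ratio_g_le_one {x : ℝ} (h0 : 0 ≤ x) (h1 : x ≤ 1) : ratio x (g x 1) ≤ 1 := by
  have := ratio_g_le h0 h1
  have := mul_nonneg half_pos.le h0
  linarith

theorem g_nonneg {x : ℝ} (h0 : 0 ≤ x) (h1 : x ≤ 1) : 0 ≤ g x 1 := by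
  rw [← ratio_mul_self]
  exact mul_nonneg (ratio_g_nonneg h1) h0

theorem g_le {x : ℝ} (h0 : 0 ≤ x) (h1 : x ≤ 1) :
    g x 1 ≤ x - (1 - 1 / exp 1) / 2 * x ^ 2 := by
  rw [← ratio_mul_self]
  nlinarith [ratio_g_le h0 h1]

/-- The right side equals `exp 1 + 1` at 1, so it suffices that it decreases on [1/2, 1]. Its
derivative is exp x - exp(1 - x) minus the chord of that function over [1/2, 1], hence nonpositive
by convexity. -/
theorem exp_add_exp_one_sub_ge_of_half_le {x : ℝ} (h0 : 1 / 2 ≤ x) (h1 : x ≤ 1) :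
    exp 1 + 1 ≤ exp x + exp (1 - x) + (exp 1 - 1) * (x * (1 - x)) := by
  have hd (x : ℝ) : HasDerivAt (fun x => exp x + exp (1 - x) + (exp 1 - 1) * (x * (1 - x)))
      (exp x - exp (1 - x) - (exp 1 - 1) * (2 * x - 1)) x := by
    have h1 : HasDerivAt (fun x : ℝ => exp (1 - x)) (-exp (1 - x)) x := by
      simpa using ((hasDerivAt_id x).const_sub 1).exp
    have h2 : HasDerivAt (fun x : ℝ => (exp 1 - 1) * (x * (1 - x)))
        ((exp 1 - 1) * (1 - 2 * x)) x := by
      exact (((hasDerivAt_id' x).mul ((hasDerivAt_id' x).const_sub 1)).const_mul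
        (exp 1 - 1)).congr_deriv (by ring)
    exact (((Real.hasDerivAt_exp x).add h1).add h2).congr_deriv (by ring)
  have hcv : ConvexOn ℝ (Set.Icc (1 / 2 : ℝ) 1) fun x => exp x - exp (1 - x) := by
    have hk (x : ℝ) : HasDerivAt (fun x => exp x - exp (1 - x)) (exp x + exp (1 - x)) x := by
      have h1 : HasDerivAt (fun x : ℝ => exp (1 - x)) (-exp (1 - x)) x := by
        simpa using ((hasDerivAt_id x).const_sub 1).exp
      exact ((Real.hasDerivAt_exp x).sub h1).congr_deriv (by ring)
    have hk2 (x : ℝ) : HasDerivAt (fun x => exp x + exp (1 - x)) (exp x - exp (1 - x)) x := by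
      have h1 : HasDerivAt (fun x : ℝ => exp (1 - x)) (-exp (1 - x)) x := by
        simpa using ((hasDerivAt_id x).const_sub 1).exp
      exact ((Real.hasDerivAt_exp x).add h1).congr_deriv (by ring)
    refine convexOn_of_hasDerivWithinAt2_nonneg (convex_Icc _ _)
      (fun x _ => (hk x).continuousAt.continuousWithinAt)
      (fun x _ => (hk x).hasDerivWithinAt) (fun x _ => (hk2 x).hasDerivWithinAt) ?_
    intro x hx
    rw [interior_Icc] at hx
    exact sub_nonneg.2 (exp_le_exp.2 (by linarith [hx.1]))
  have hle {x : ℝ} (h0 : 1 / 2 ≤ x) (h1 : x ≤ 1) :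
      exp x - exp (1 - x) - (exp 1 - 1) * (2 * x - 1) ≤ 0 := by
    have := hcv.2 (show (1 / 2 : ℝ) ∈ Set.Icc (1 / 2) 1 by norm_num)
      (show (1 : ℝ) ∈ Set.Icc (1 / 2) 1 by norm_num)
      (show 0 ≤ 2 * (1 - x) by linarith) (show 0 ≤ 2 * x - 1 by linarith) (by ring)
    simp only [smul_eq_mul] at this
    rw [show 2 * (1 - x) * (1 / 2) + (2 * x - 1) * 1 = x by ring,
      show (1 - 1 / 2 : ℝ) = 1 / 2 by norm_num] at this
    simp at this
    linarith
  have hanti : AntitoneOn (fun x => exp x + exp (1 - x) + (exp 1 - 1) * (x * (1 - x)))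
      (Set.Icc (1 / 2 : ℝ) 1) := by
    refine antitoneOn_of_hasDerivWithinAt_nonpos (convex_Icc _ _)
      (fun x _ => (hd x).continuousAt.continuousWithinAt)
      (fun x _ => (hd x).hasDerivWithinAt) ?_
    intro x hx
    rw [interior_Icc] at hx
    exact hle hx.1.le hx.2.le
  have := hanti ⟨h0, h1⟩ ⟨by norm_num, le_rfl⟩ h1
  simpa using this

theorem exp_add_exp_one_sub_ge {x : ℝ} (h0 : 0 ≤ x) (h1 : x ≤ 1) :
    exp 1 + 1 ≤ exp x + exp (1 - x) + (exp 1 - 1) * (x * (1 - x)) := by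
  rcases le_total (1 / 2) x with h | h
  · exact exp_add_exp_one_sub_ge_of_half_le h h1
  · have := exp_add_exp_one_sub_ge_of_half_le (x := 1 - x) (by linarith) (by linarith)
    rw [sub_sub_cancel] at this
    linarith

/-- For x < 1, clearing the denominator of g in 1 - exp(-x) ≤ g(x) leaves exactly
`exp_add_exp_one_sub_ge`. -/
theorem one_sub_g_le_exp {x : ℝ} (h0 : 0 ≤ x) (h1 : x ≤ 1) : 1 - g x 1 ≤ exp (-x) := by
  rcases h1.eq_or_lt with rfl | h
  · rw [g_one_one]
    linarith
  · have : 1 - exp (-x) ≤ g x 1 := by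
      rw [g_of_lt h, le_div_iff₀ (exp_lt_chord_pos h)]
      have h2 := exp_add_exp_one_sub_ge h0 h1
      have h3 : exp (-x) * exp 1 = exp (1 - x) := by rw [← exp_add]; ring_nf
      have h4 : exp (-x) * exp x = 1 := by rw [← exp_add]; simp
      nlinarith
    linarith

theorem prod_one_sub_g_le {ι : Type*} (s : Finset ι) (x : ι → ℝ) (h0 : ∀ i ∈ s, 0 ≤ x i)
    (h1 : ∀ i ∈ s, x i ≤ 1) : ∏ i ∈ s, (1 - g (x i) 1) ≤ exp (-∑ i ∈ s, x i) := by
  rw [← Finset.sum_neg_distrib, exp_sum]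
  refine Finset.prod_le_prod (fun i hi => ?_) fun i hi => one_sub_g_le_exp (h0 i hi) (h1 i hi)
  have := g_le (h0 i hi) (h1 i hi)
  nlinarith [half_pos, h1 i hi, mul_nonneg half_pos.le (sq_nonneg (x i))]

/-- With φ(t) = 1 - t + c t², each factor is at least φ(x_i), and φ(a + b) ≤ φ(a) φ(b) when a, b ≥ 0
and a + b ≤ 1. So the product is at least φ of the sum, and φ ≥ φ(1) = c on [0, 1]. -/
theorem le_prod_one_sub_g {ι : Type*} (s : Finset ι) (x : ι → ℝ) (h0 : ∀ i ∈ s, 0 ≤ x i)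
    (h1 : ∑ i ∈ s, x i ≤ 1) : (1 - 1 / exp 1) / 2 ≤ ∏ i ∈ s, (1 - g (x i) 1) := by
  have hc0 := half_pos
  have hc3 := three_mul_half_le
  have key : 1 - ∑ i ∈ s, x i + (1 - 1 / exp 1) / 2 * (∑ i ∈ s, x i) ^ 2 ≤
      ∏ i ∈ s, (1 - g (x i) 1) := by
    classical
    induction s using Finset.induction_on with
    | empty => simp
    | insert i s hi ih =>
      rw [Finset.sum_insert hi] at h1
      rw [Finset.sum_insert hi, Finset.prod_insert hi]
      simp only [Finset.forall_mem_insert] at h0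
      have hs := Finset.sum_nonneg h0.2
      have ih := ih h0.2 (by linarith)
      set b := ∑ i ∈ s, x i
      set a := x i
      have ha1 : a ≤ 1 := by linarith
      have hg := g_le h0.1 ha1
      set c := (1 - 1 / exp 1) / 2
      have hb : 0 ≤ 1 - b + c * b ^ 2 := by nlinarith [mul_nonneg hc0.le (sq_nonneg b)]
      have ha : 0 ≤ 1 - a + c * a ^ 2 := by nlinarith [mul_nonneg hc0.le (sq_nonneg a)]
      calc 1 - (a + b) + c * (a + b) ^ 2 ≤ (1 - a + c * a ^ 2) * (1 - b + c * b ^ 2) := by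
            have hab : 0 ≤ a * b := mul_nonneg h0.1 hs
            have : 0 ≤ 1 - 2 * c - c * (a + b) + c ^ 2 * (a * b) := by
              -- This quantity times ab is φ(a) φ(b) - φ(a + b).
              nlinarith [mul_nonneg (sq_nonneg c) hab]
            nlinarith [mul_nonneg hab this]
        _ ≤ (1 - g a 1) * ∏ i ∈ s, (1 - g (x i) 1) :=
            mul_le_mul (by linarith) ih hb (by linarith)
  have hs := Finset.sum_nonneg h0
  refine le_trans ?_ key
  set c := (1 - 1 / exp 1) / 2
  set t := ∑ i ∈ s, x i
  nlinarith [mul_nonneg (sub_nonneg.2 h1) (show 0 ≤ 1 - c * (1 + t) by nlinarith)]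

/-- The defining property of `g`: `g(x) / x * (1 - e^{x-1}) = (1 - 1/e) (1 - x)`. -/
theorem ratio_g_mul {x : ℝ} (h1 : x ≤ 1) :
    ratio x (g x 1) * ((1 - exp (-(1 - x))) / 2) = (1 - 1 / exp 1) / 2 * (1 - x) := by
  rcases h1.eq_or_lt with rfl | h
  · simp
  · rw [ratio_g_of_lt h]
    have h2 := exp_lt_chord_pos h
    have h3 : exp (-(1 - x)) = exp x / exp 1 := by rw [← exp_sub]; ring_nf
    rw [h3]
    field_simp

/-- The second summand is c(1 - x) and the first is at least cx. -/
theorem half_le_ratio_g {x : ℝ} (h0 : 0 ≤ x) (h1 : x ≤ 1) :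
    (1 - 1 / exp 1) / 2 ≤ (1 - ratio x (g x 1)) +
      ratio x (g x 1) * ((1 - exp (-(1 - x))) / 2) := by
  rw [ratio_g_mul h1]
  linarith [ratio_g_le h0 h1]

end Analysis

/-! ### Graphs whose values sum to 1 at every right vertex. -/

section Saturated

variable {V U : Type*} [DecidableEq V] [DecidableEq U]

/-- The probability with which `w` proposes to `u` in a run with `x̃ = g(x, 1)`. -/
noncomputable def proposalProb (E : Finset (V × U)) (x : V × U → ℝ) (w : V) (u : U) : ℝ :=
  if (w, u) ∈ E then g (x (w, u)) 1 else 0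

theorem expect_scan_proposes {G : BipartiteGraph V U} {x : V × U → ℝ} {v : V}
    {D : PMF (List (V × U))} (hD : IsProportional G x v D) {f : V × U} (hf : f ∈ G.E)
    (hv : f.1 = v) :
    (expect D fun l => expect (scan G.p l) (proposes f)) = ENNReal.ofReal (x f) := by
  rw [← expect_bind, ← hD.prob_eq f hf hv, ← expect_single, expect_map]
  refine expect_congr fun r _ => ?_
  by_cases h : r.2 = some f <;> simp [proposes, h]

theorem hasProposalLaw {G : BipartiteGraph V U} {x : V × U → ℝ} {D : V → PMF (List (V × U))}
    (hD : ∀ v, IsProportional G x v (D v)) (h0 : ∀ f ∈ G.E, 0 ≤ x f) (h1 : ∀ f ∈ G.E, x f ≤ 1) :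
    HasProposalLaw G.p x (fun e => g (x e) 1) D G.E (proposalProb G.E x) where
  isOutcome w r hr := isOutcome_of_mem_support (fun l hl => ((hD w).perm l hl).2) hr
  nonneg w u := by
    unfold proposalProb
    split_ifs with h
    · exact g_nonneg (h0 _ h) (h1 _ h)
    · exact le_rfl
  le_one w u := by
    unfold proposalProb
    split_ifs with h
    · have := g_le (h0 _ h) (h1 _ h)
      nlinarith [half_pos, h1 _ h, mul_nonneg half_pos.le (sq_nonneg (x (w, u)))]
    · exact zero_le_one
  prob w u := by
    unfold proposalProb
    split_ifs with h
    · rw [outcome, expect_bind, ← ratio_mul_self, ENNReal.ofReal_mul (ratio_g_nonneg (h1 _ h)),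
        ← expect_scan_proposes (hD w) h rfl, ← expect_const_mul]
      refine expect_congr fun l hl => expect_thinScan_proposes _ _ _ _ _ (fun f hf => ?_)
        fun f hf => ?_
      · exact ratio_g_nonneg (h1 f (((hD w).perm l hl).2 f hf).1)
      · have hfE := (((hD w).perm l hl).2 f hf).1
        exact ratio_g_le_one (h0 f hfE) (h1 f hfE)
    · rw [ENNReal.ofReal_zero, ← expect_const (outcome G.p x (fun e => g (x e) 1) (D w)) 0]
      refine expect_congr fun r hr => ?_
      have hr' := isOutcome_of_mem_support (fun l hl => ((hD w).perm l hl).2) hr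
      have : r.2 ≠ some (w, u) := fun hu => h (hr'.1 _ (hr'.2 _ hu)).1
      simp [proposes, this]

variable [Fintype V]

theorem prod_erase_proposalProb (E : Finset (V × U)) (x : V × U → ℝ) (v : V) (u : U) :
    ∏ w ∈ Finset.univ.erase v, (1 - proposalProb E x w u) =
      ∏ w ∈ Finset.univ.erase v with (w, u) ∈ E, (1 - g (x (w, u)) 1) := by
  rw [Finset.prod_filter]
  refine Finset.prod_congr rfl fun w _ => ?_
  unfold proposalProb
  split_ifs <;> simp

/-- The bound for a graph in which the values of the edges at every right vertex sum to `1`. -/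
theorem le_expect_free {G : BipartiteGraph V U} {x : V × U → ℝ} {D : V → PMF (List (V × U))}
    (hD : ∀ v, IsProportional G x v (D v)) (h0 : ∀ f ∈ G.E, 0 ≤ x f) (h1 : ∀ f ∈ G.E, x f ≤ 1)
    (hsum : ∀ u, ∑ w with (w, u) ∈ G.E, x (w, u) = 1) {e : V × U} (he : e ∈ G.E)
    (hp : 0 < (G.p e : ℝ)) :
    ENNReal.ofReal ((1 - g (x e) 1 / G.p e) * ((1 - 1 / Real.exp 1) / 2) ^ 2) ≤
      expect (randomOrder V) fun l =>
        expect (turns G.p x (fun e => g (x e) 1) D l ⟨∅, ∅⟩) ({s | Free e s}.indicator 1) := by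
  refine le_trans ?_ ((hasProposalLaw hD h0 h1).expect_meanValue_le e)
  set c := (1 - 1 / Real.exp 1) / 2 with hc
  have hc0 : 0 < c := half_pos
  have hlist {l : List (V × U)} (hl : l ∈ (D e.1).support) : ∀ f ∈ l, f ∈ G.E ∧ f.1 = e.1 :=
    ((hD e.1).perm l hl).2
  have hrn {l : List (V × U)} (hl : l ∈ (D e.1).support) :
      ∀ f ∈ l, 0 ≤ ratio (x f) (g (x f) 1) := fun f hf => ratio_g_nonneg (h1 f (hlist hl f hf).1)
  have hrl {l : List (V × U)} (hl : l ∈ (D e.1).support) :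
      ∀ f ∈ l, ratio (x f) (g (x f) 1) ≤ 1 := fun f hf =>
    ratio_g_le_one (h0 f (hlist hl f hf).1) (h1 f (hlist hl f hf).1)
  set P := ∏ w ∈ Finset.univ.erase e.1, (1 - proposalProb G.E x w e.2)
  have hP : c ≤ P := by
    unfold P
    rw [prod_erase_proposalProb]
    refine le_prod_one_sub_g _ _ (fun w hw => h0 _ (Finset.mem_filter.1 hw).2) ?_
    rw [← hsum e.2]
    refine Finset.sum_le_sum_of_subset_of_nonneg
      (Finset.filter_subset_filter _ (Finset.subset_univ _))
      fun w hw _ => h0 _ (Finset.mem_filter.1 hw).2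
  -- Saturation is essential here: the edges at `f.2` other than f carry total value exactly 1 -
  -- x_f.
  have hR {f : V × U} (hf : f ∈ G.E) (hfe : f.1 = e.1) :
      ∏ w ∈ Finset.univ.erase e.1, (1 - proposalProb G.E x w f.2) ≤
        Real.exp (-(1 - x f)) := by
    rw [prod_erase_proposalProb]
    refine (prod_one_sub_g_le _ (fun w => x (w, f.2)) (fun w hw => h0 _ (Finset.mem_filter.1 hw).2)
      fun w hw => h1 _ (Finset.mem_filter.1 hw).2).trans_eq ?_
    have hmem : e.1 ∈ ({w | (w, f.2) ∈ G.E} : Finset V) := by simpa [← hfe] using hf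
    rw [← hsum f.2, ← Finset.add_sum_erase _ _ hmem, Finset.filter_erase, ← hfe]
    simp
  have hmean (l : List (V × U)) (hl : l ∈ (D e.1).support) :
      ENNReal.ofReal (c ^ 2) * expect (thinScan G.p x (fun e => g (x e) 1) l)
        (unexamined e fun _ => 1) ≤ expect (thinScan G.p x (fun e => g (x e) 1) l)
          (unexamined e (meanValue (proposalProb G.E x) e.1 e.2)) := by
    have hc1 : c ≤ 1 := by linarith [show 3 * c ≤ 1 from three_mul_half_le]
    refine mul_expect_unexamined_le _ _ _ _ _ (hrn hl) (hrl hl) _ _ ?_ ?_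
    · refine ENNReal.ofReal_le_ofReal (le_trans ?_ hP)
      nlinarith
    · intro f hf hfe
      have hfE := (hlist hl f hf).1
      have hr0 := hrn hl f hf
      have hr1 := hrl hl f hf
      have hb := hR hfE (hlist hl f hf).2
      have hb1 : Real.exp (-(1 - x f)) ≤ 1 := Real.exp_le_one_iff.2 (by linarith [h1 f hfE])
      have hval := half_le_ratio_g (h0 f hfE) (h1 f hfE)
      simp only [meanValue]
      set R := ∏ w ∈ Finset.univ.erase e.1, (1 - proposalProb G.E x w f.2)
      set r := ratio (x f) (g (x f) 1)
      have hP0 : 0 ≤ P := hc0.le.trans hP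
      rw [← ENNReal.ofReal_mul (sub_nonneg.2 hr1), ← ENNReal.ofReal_mul hr0,
        ← ENNReal.ofReal_add (mul_nonneg (sub_nonneg.2 hr1) hP0)
          (mul_nonneg hr0 (mul_nonneg hP0 (by linarith)))]
      refine ENNReal.ofReal_le_ofReal ?_
      calc c ^ 2 = c * c := sq c
        _ ≤ P * (1 - r + r * ((1 - R) / 2)) := by
          refine mul_le_mul hP (hval.trans ?_) hc0.le hP0
          gcongr
        _ = _ := by ring
  have hunex : 1 ≤ expect (outcome G.p x (fun e => g (x e) 1) (D e.1)) (unexamined e fun _ => 1) +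
      ENNReal.ofReal (g (x e) 1 / G.p e) := by
    have hk : g (x e) 1 / G.p e = ratio (x e) (g (x e) 1) / G.p e * x e := by
      rw [div_mul_eq_mul_div, ratio_mul_self]
    rw [hk, ENNReal.ofReal_mul (div_nonneg (ratio_g_nonneg (h1 e he)) hp.le),
      ← expect_scan_proposes (hD e.1) he rfl, ← expect_const_mul, outcome, expect_bind, ← expect_add]
    conv_lhs => rw [← expect_const (D e.1) 1]
    exact expect_mono fun l hl => one_le_expect_unexamined_add _ _ _ _ hp _ (hrn hl) (hrl hl)
  calc ENNReal.ofReal ((1 - g (x e) 1 / G.p e) * c ^ 2)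
      = ENNReal.ofReal (c ^ 2) * (1 - ENNReal.ofReal (g (x e) 1 / G.p e)) := by
        rw [mul_comm, ENNReal.ofReal_mul (sq_nonneg c), ENNReal.ofReal_sub _
          (div_nonneg (g_nonneg (h0 e he) (h1 e he)) hp.le), ENNReal.ofReal_one]
    _ ≤ ENNReal.ofReal (c ^ 2) *
        expect (outcome G.p x (fun e => g (x e) 1) (D e.1)) (unexamined e fun _ => 1) := by
        gcongr
        exact tsub_le_iff_right.2 hunex
    _ ≤ _ := by
        rw [outcome, expect_bind, expect_bind, ← expect_const_mul]
        exact expect_mono hmean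

end Saturated

/-! ### The dummy edges saturate every right vertex. -/

section Dummies

variable {A B : Type*} [Fintype A] [Fintype B] [DecidableEq A] [DecidableEq B]
  {G : BipartiteGraph A B} {x : A × B → ℝ}

theorem inl_mem_withDummies {a : A} {b : B} :
    (Sum.inl a, b) ∈ (withDummies G).E ↔ (a, b) ∈ G.E := by
  simp [withDummies, lift]

theorem inr_mem_withDummies {b b' : B} : (Sum.inr b', b) ∈ (withDummies G).E ↔ b' = b := by
  simp [withDummies, lift]

theorem IsLPSolution.le_one (hx : IsLPSolution G x) {e : A × B} (he : e ∈ G.E) : x e ≤ 1 := by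
  have := hx.left e.1 {e} (by simpa using he) (by simp)
  simp only [Finset.sum_singleton, Finset.prod_singleton, sub_sub_cancel] at this
  exact this.trans (G.p e).2.2

theorem IsLPSolution.sum_le_one (hx : IsLPSolution G x) (u : B) :
    ∑ e ∈ G.E with e.2 = u, x e ≤ 1 := by
  refine (hx.right u _ (Finset.filter_subset _ _) fun e he => (Finset.mem_filter.1 he).2).trans ?_
  rw [sub_le_self_iff]
  exact Finset.prod_nonneg fun e _ => sub_nonneg.2 (G.p e).2.2

theorem IsLPSolution.withDummyValues_mem (hx : IsLPSolution G x) :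
    ∀ f ∈ (withDummies G).E, 0 ≤ withDummyValues G x 1 f ∧ withDummyValues G x 1 f ≤ 1 := by
  rintro ⟨a | b', b⟩ hf
  · rw [inl_mem_withDummies] at hf
    exact ⟨hx.nonneg _ hf, hx.le_one hf⟩
  · refine ⟨sub_nonneg.2 (hx.sum_le_one b), sub_le_self _ ?_⟩
    exact Finset.sum_nonneg fun e he => hx.nonneg e (Finset.mem_filter.1 he).1

theorem sum_withDummyValues (G : BipartiteGraph A B) (x : A × B → ℝ) (u : B) :
    ∑ w with (w, u) ∈ (withDummies G).E, withDummyValues G x 1 (w, u) = 1 := by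
  rw [Finset.sum_filter, Fintype.sum_sum_type]
  simp only [inl_mem_withDummies, inr_mem_withDummies, withDummyValues, Finset.sum_ite_eq',
    Finset.mem_univ, if_true]
  have : ∑ a : A, (if (a, u) ∈ G.E then x (a, u) else 0) = ∑ e ∈ G.E with e.2 = u, x e := by
    rw [← Finset.sum_filter]
    refine Finset.sum_bij (fun a _ => (a, u)) ?_ ?_ ?_ ?_
    · intro a ha
      simpa using ha
    · intro a _ a' _ h
      exact (Prod.mk.inj h).1
    · rintro ⟨a, b⟩ h
      obtain ⟨hm, rfl⟩ := Finset.mem_filter.1 h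
      exact ⟨a, by simpa using hm, rfl⟩
    · intro a _
      rfl
  rw [this]
  ring

end Dummies

end StochasticMatching

/-! ### The theorem for the original graph. -/

theorem lemma4 {A B : Type*} [Fintype A] [Fintype B] [DecidableEq A] [DecidableEq B]
    (G : StochasticMatching.BipartiteGraph A B) (x : A × B → ℝ)
    (hx : StochasticMatching.IsLPSolution G x)
    (D : A ⊕ B → PMF (List ((A ⊕ B) × B)))
    (hD : ∀ v, StochasticMatching.IsProportional (StochasticMatching.withDummies G)
      (StochasticMatching.withDummyValues G x 1) v (D v))
    (e : A × B) (he : e ∈ G.E) (hp : 0 < (G.p e : ℝ)) :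
    (1 - StochasticMatching.g (x e) 1 / (G.p e : ℝ)) * ((1 - 1 / Real.exp 1) / 2) ^ 2 ≤
      StochasticMatching.prob (StochasticMatching.alg1 G x 1 D)
        {s | e ∈ StochasticMatching.available G s} := by
  open StochasticMatching in
  have hmem := hx.withDummyValues_mem
  -- On `lift e` the enlarged data reduce definitionally to x e and p e, so the bound is already the
  -- one claimed.
  have hmain := le_expect_free (G := withDummies G) hD (fun f hf => (hmem f hf).1)
    (fun f hf => (hmem f hf).2) (sum_withDummyValues G x) (e := lift e)
    (inl_mem_withDummies.2 he) hp
  have hset : {s : State (A ⊕ B) B | e ∈ available G s} = {s | Free (lift e) s} := by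
    ext s
    simp [available, Free, he]
  rw [prob, hset]
  refine (ENNReal.ofReal_le_iff_le_toReal ?_).1 ?_
  · rw [← expect_indicator]
    refine ne_top_of_le_ne_top ENNReal.one_ne_top ?_
    rw [← expect_const (alg1 G x 1 D) 1]
    exact expect_mono fun s _ => Set.indicator_le_self' (by simp) s
  · rw [← expect_indicator, alg1, expect_bind]
    exact hmain
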